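/- A ternary $[n,k,d]$ code is a $k$-dimensional subspace $C$ of $\mathbb{F}_3^n$ whose minimum weight (the least number of non-zero coordinates of a non-zero element of $C$) is exactly $d$. It is called LCD (linear complementary dual) if $C\cap C^{\perp}=\{0\}$, where $C^{\perp}=\{x\in\mathbb{F}_3^n : \sum_{i=1}^n x_iy_i=0 \text{ for all } y\in C\}$. **Corollary.** Let $$\mathcal{P}_3=\{(34,22,7),\,(37,23,7),\,(37,29,5),\,(40,30,5)\},$$ $$\mathcal{P}'_3=\{(34,21,7),\,(37,22,7),\,(37,28,5),\,(40,29,5)\}.$$ Suppose that $(n,k,d)\in\mathcal{P}_3\cup\mathcal{P}'_3$. Then for every integer $s\ge 0$ there is a ternary LCD $$\left[n+\frac{3^k-1}{2}\,s,\;k,\;d+3^{k-1}s\right]$$ code. -/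

import Mathlib

namespace LCDCode

/-- A linear code of length `n` over `F`: a vector subspace of `F ^ n`. -/
abbrev LinearCode (F : Type*) [Field F] (n : ℕ) : Type _ := Submodule F (Fin n → F)

/-- The (Euclidean) dual code, for the form `⟨x, y⟩ = ∑ i, x i * y i`. -/
def dual {F : Type*} [Field F] {n : ℕ} (C : LinearCode F n) : LinearCode F n where
  carrier := {x | ∀ y ∈ C, ∑ i, x i * y i = 0}
  add_mem' := by
    intro a b ha hb y hy
    simp only [Pi.add_apply, add_mul, Finset.sum_add_distrib, ha y hy, hb y hy, add_zero]
  zero_mem' := by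
    intro y _
    simp
  smul_mem' := by
    intro c x hx y hy
    simp only [Pi.smul_apply, smul_eq_mul, mul_assoc, ← Finset.mul_sum, hx y hy, mul_zero]

/-- Linear complementary dual codes: `C ∩ C^⊥ = {0}`. -/
def IsLCD {F : Type*} [Field F] {n : ℕ} (C : LinearCode F n) : Prop :=
  C ⊓ dual C = ⊥

/-- `C` has minimum weight `d`: the least number of non-zero coordinates of a non-zero codeword
exists and equals `d`. -/
def HasMinWeight {F : Type*} [Field F] [DecidableEq F] {n : ℕ} (C : LinearCode F n)
    (d : ℕ) : Prop :=
  IsLeast {w : ℕ | ∃ x ∈ C, x ≠ 0 ∧ w = hammingNorm x} d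

/-- There is an LCD `[n, k, d]` code over `F`. -/
def ExistsLCDCode (F : Type*) [Field F] [DecidableEq F] (n k d : ℕ) : Prop :=
  ∃ C : LinearCode F n, Module.finrank F C = k ∧ HasMinWeight C d ∧ IsLCD C

/-- The parameters `𝒫₃`. -/
def P3 : Finset (ℕ × ℕ × ℕ) :=
  {(34, 22, 7), (37, 23, 7), (37, 29, 5), (40, 30, 5)}

/-- The parameters `𝒫′₃`. -/
def P3' : Finset (ℕ × ℕ × ℕ) :=
  {(34, 21, 7), (37, 22, 7), (37, 28, 5), (40, 29, 5)}

end LCDCode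

/-!
Every non-zero word of the simplex code of dimension `k` has weight `3 ^ (k - 1)`. For `2 ≤ k` the
weights are divisible by `3`, so the simplex code is self-orthogonal, and prolonging the words of an
LCD code by those of a simplex code changes no inner product: the code stays LCD. It remains to find
the codes with `s = 0`.

The parameters in `𝒫₃` come in two pairs. A parity-check matrix `H` with `H * Hᵀ` invertible defines
an LCD code, and adjoining a row of `H`, prolonged by the isotropic tail `(1, 1, 1)`, raises the
dimension by one (Construction X). For the parameters in `𝒫′₃`, pass from an LCD code to the
orthogonal complement in it of an anisotropic word `v`. The minimum weight `d` is prime to `3`, so a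
word `w` of weight `d` is itself anisotropic, and `v` can be found in the orthogonal complement of
`w`; then `w` remains in the smaller code.
-/

namespace LCDCode

open Module Matrix
open scoped LinearAlgebra.Projectivization

section HammingNorm

variable {ι κ : Type*} [Fintype ι] [Fintype κ]

section Zero

variable {M : Type*} [Zero M] [DecidableEq M]

theorem hammingNorm_comp_equiv (e : κ ≃ ι) (x : ι → M) : hammingNorm (x ∘ e) = hammingNorm x :=
  Finset.card_equiv e (by simp)

theorem hammingNorm_sumElim (x : ι → M) (y : κ → M) :
    hammingNorm (Sum.elim x y) = hammingNorm x + hammingNorm y := by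
  simp only [hammingNorm, Finset.card_filter, Fintype.sum_sum_type, Sum.elim_inl, Sum.elim_inr]
  rfl

theorem hammingNorm_succ {n : ℕ} (x : Fin (n + 1) → M) :
    hammingNorm x = (if x 0 ≠ 0 then 1 else 0) + hammingNorm (Fin.tail x) := by
  simp only [hammingNorm, Finset.card_filter, Fin.sum_univ_succ]
  rfl

end Zero

theorem hammingNorm_smul_of_ne_zero {F : Type*} [Field F] [DecidableEq F] {a : F} (ha : a ≠ 0)
    (x : ι → F) : hammingNorm (a • x) = hammingNorm x :=
  hammingNorm_smul (fun _ => IsSMulRegular.of_ne_zero ha) x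

theorem exists_eq_add_of_hammingNorm_le {M : Type*} [AddZeroClass M] [DecidableEq M]
    {x : ι → M} {a b : ℕ} (h : hammingNorm x ≤ a + b) :
    ∃ y z, x = y + z ∧ hammingNorm y ≤ a ∧ hammingNorm z ≤ b := by
  classical
  obtain ⟨A, hA, hcard⟩ := Finset.exists_subset_card_eq
    (min_le_right a (Finset.univ.filter (x · ≠ 0)).card)
  refine ⟨fun i => if i ∈ A then x i else 0, fun i => if i ∈ A then 0 else x i, ?_, ?_, ?_⟩
  · ext i
    by_cases hi : i ∈ A <;> simp [hi]
  · refine (Finset.card_le_card fun i => ?_).trans (hcard.le.trans (min_le_left _ _))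
    simp +contextual
  · have hsub : Finset.univ.filter (fun i => (if i ∈ A then 0 else x i) ≠ 0) ⊆
        Finset.univ.filter (x · ≠ 0) \ A := fun i => by simp +contextual
    refine (Finset.card_le_card hsub).trans ?_
    rw [Finset.card_sdiff_of_subset hA, hcard]
    change (Finset.univ.filter (x · ≠ 0)).card ≤ _ at h
    omega

end HammingNorm

/-! ### LCD codes -/

section LCD

variable {F : Type*} [Field F] {n k d : ℕ}

theorem IsLCD.eq_zero {C : LinearCode F n} (hC : IsLCD C) {x : Fin n → F} (hx : x ∈ C)
    (h : ∀ y ∈ C, x ⬝ᵥ y = 0) : x = 0 := by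
  have hmem : x ∈ C ⊓ dual C := ⟨hx, h⟩
  rwa [hC, Submodule.mem_bot] at hmem

theorem isLCD_of_forall_eq_zero {C : LinearCode F n}
    (h : ∀ x ∈ C, (∀ y ∈ C, x ⬝ᵥ y = 0) → x = 0) : IsLCD C :=
  (Submodule.eq_bot_iff _).2 fun x hx => h x hx.1 hx.2

theorem mem_dual_span_singleton {v x : Fin n → F} : x ∈ dual (F ∙ v) ↔ x ⬝ᵥ v = 0 := by
  refine ⟨fun h => h v (Submodule.mem_span_singleton_self v), fun h y hy => ?_⟩
  obtain ⟨a, rfl⟩ := Submodule.mem_span_singleton.1 hy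
  change x ⬝ᵥ a • v = 0
  rw [dotProduct_smul, h, smul_zero]

theorem dotProduct_eq_zero_of_forall_self {V ι : Type*} [AddCommGroup V] [Module F V] [Fintype ι]
    (h2 : (2 : F) ≠ 0) (φ : V →ₗ[F] ι → F) (h : ∀ v, φ v ⬝ᵥ φ v = 0) (v w : V) :
    φ v ⬝ᵥ φ w = 0 := by
  have hvw := h (v + w)
  rw [map_add, add_dotProduct, dotProduct_add, dotProduct_add, h, h, dotProduct_comm (φ w),
    zero_add, add_zero, ← two_mul] at hvw
  exact (mul_eq_zero.1 hvw).resolve_left h2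

theorem IsLCD.exists_dotProduct_self_ne_zero {C : LinearCode F n} (hC : IsLCD C)
    (h2 : (2 : F) ≠ 0) (hne : C ≠ ⊥) : ∃ v ∈ C, v ⬝ᵥ v ≠ 0 := by
  by_contra! hself
  refine hne ((Submodule.eq_bot_iff C).2 fun x hx => hC.eq_zero hx fun y hy => ?_)
  exact dotProduct_eq_zero_of_forall_self h2 C.subtype (fun v => hself v v.2) ⟨x, hx⟩ ⟨y, hy⟩

theorem IsLCD.inf_dual_span_singleton {C : LinearCode F n} (hC : IsLCD C) {v : Fin n → F}
    (hv : v ∈ C) (hvv : v ⬝ᵥ v ≠ 0) : IsLCD (C ⊓ dual (F ∙ v)) := by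
  refine isLCD_of_forall_eq_zero fun x hx horth => hC.eq_zero hx.1 fun y hy => ?_
  have hxv : x ⬝ᵥ v = 0 := mem_dual_span_singleton.1 hx.2
  set a := (y ⬝ᵥ v) / (v ⬝ᵥ v)
  have hproj : y - a • v ∈ C ⊓ dual (F ∙ v) := by
    refine ⟨C.sub_mem hy (C.smul_mem _ hv), mem_dual_span_singleton.2 ?_⟩
    rw [sub_dotProduct, smul_dotProduct, smul_eq_mul, div_mul_cancel₀ _ hvv, sub_self]
  simpa only [dotProduct_sub, dotProduct_smul, hxv, smul_zero, sub_zero] using horth _ hproj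

theorem finrank_inf_dual_span_singleton {C : LinearCode F n} {v : Fin n → F} (hv : v ∈ C)
    (hvv : v ⬝ᵥ v ≠ 0) : finrank F ↥(C ⊓ dual (F ∙ v)) + 1 = finrank F C := by
  let f : Dual F C := (dotProductBilin F F v).comp C.subtype
  have hf : f ≠ 0 := fun h => hvv (LinearMap.congr_fun h ⟨v, hv⟩)
  have hmap : (LinearMap.ker f).map C.subtype = C ⊓ dual (F ∙ v) := by
    ext x
    simp only [f, Submodule.mem_map, LinearMap.mem_ker, Submodule.mem_inf, mem_dual_span_singleton]
    constructor
    · rintro ⟨y, hy, rfl⟩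
      exact ⟨y.2, (dotProduct_comm _ _).trans hy⟩
    · rintro ⟨hx, hxv⟩
      exact ⟨⟨x, hx⟩, (dotProduct_comm _ _).trans hxv, rfl⟩
  rw [← Dual.finrank_ker_add_one_of_ne_zero hf, ← hmap, Submodule.finrank_map_subtype_eq]

variable [DecidableEq F] {ι : Type*} [Fintype ι]

theorem existsLCDCode_of_linearMap {V : Type*} [AddCommGroup V] [Module F V]
    (φ : V →ₗ[F] ι → F) (hn : Fintype.card ι = n) (hk : finrank F V = k)
    (hd : ∀ v ≠ 0, d ≤ hammingNorm (φ v)) (hd' : ∃ v ≠ 0, hammingNorm (φ v) = d)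
    (hφ : ∀ v, (∀ w, φ v ⬝ᵥ φ w = 0) → v = 0) : ExistsLCDCode F n k d := by
  let e : Fin n ≃ ι := (Fintype.equivFinOfCardEq hn).symm
  let ψ : V →ₗ[F] Fin n → F := (LinearMap.funLeft F F e).comp φ
  have hnorm (v : V) : hammingNorm (ψ v) = hammingNorm (φ v) := hammingNorm_comp_equiv e (φ v)
  have hdot (v w : V) : ψ v ⬝ᵥ ψ w = φ v ⬝ᵥ φ w := comp_equiv_dotProduct_comp_equiv _ _ e
  have hker (v : V) (hv : ψ v = 0) : v = 0 := hφ v fun w => by rw [← hdot, hv, zero_dotProduct]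
  refine ⟨LinearMap.range ψ, ?_, ⟨?_, ?_⟩, isLCD_of_forall_eq_zero ?_⟩
  · rw [LinearMap.finrank_range_of_inj ((injective_iff_map_eq_zero ψ).2 hker), hk]
  · obtain ⟨v, hv, hvd⟩ := hd'
    exact ⟨ψ v, ⟨v, rfl⟩, fun h => hv (hker v h), by rw [hnorm, hvd]⟩
  · rintro w ⟨_, ⟨v, rfl⟩, hv, rfl⟩
    rw [hnorm]
    exact hd v fun h => hv (by rw [h, map_zero])
  · rintro _ ⟨v, rfl⟩ hv
    rw [hφ v fun w => by rw [← hdot, hv _ ⟨w, rfl⟩], map_zero]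

theorem existsLCDCode_constructionX {m : ℕ} {C : LinearCode F n} (hk : finrank F C = k)
    (hmin : HasMinWeight C d) (hC : IsLCD C) {w : Fin n → F} (hw : w ∈ dual C) {t : Fin m → F}
    (hwt : w ⬝ᵥ w + t ⬝ᵥ t ≠ 0) (hdist : ∀ x ∈ C, d ≤ hammingNorm (x + w) + hammingNorm t) :
    ExistsLCDCode F (n + m) (k + 1) d := by
  let φ : C × F →ₗ[F] Fin n ⊕ Fin m → F :=
    (LinearEquiv.sumArrowLequivProdArrow _ _ F F).symm.toLinearMap.comp
      ((C.subtype.coprod (LinearMap.toSpanSingleton F _ w)).prod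
        ((LinearMap.toSpanSingleton F _ t).comp (LinearMap.snd F C F)))
  have hφ (x : C) (a : F) : φ (x, a) = Sum.elim ((x : Fin n → F) + a • w) (a • t) := by
    ext (i | i) <;> rfl
  have hdot (x y : C) (a b : F) : φ (x, a) ⬝ᵥ φ (y, b) =
      (x : Fin n → F) ⬝ᵥ y + a * b * (w ⬝ᵥ w + t ⬝ᵥ t) := by
    have hwC (z : C) : w ⬝ᵥ (z : Fin n → F) = 0 := hw z z.2
    simp only [hφ, sumElim_dotProduct_sumElim, add_dotProduct, dotProduct_add, smul_dotProduct,
      dotProduct_smul, hwC, dotProduct_comm _ w, smul_eq_mul]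
    ring
  refine existsLCDCode_of_linearMap φ (by simp) (by simp [hk]) ?_ ?_ ?_
  · rintro ⟨x, a⟩ hne
    rw [hφ, hammingNorm_sumElim]
    obtain rfl | ha := eq_or_ne a 0
    · have hx : (x : Fin n → F) ≠ 0 := fun h => hne (by simp [Subtype.ext_iff, h])
      have := hmin.2 ⟨x, x.2, hx, rfl⟩
      simpa using this
    · have hsmul : (x : Fin n → F) + a • w = a • (a⁻¹ • (x : Fin n → F) + w) := by
        rw [smul_add, smul_inv_smul₀ ha]
      rw [hsmul, hammingNorm_smul_of_ne_zero ha, hammingNorm_smul_of_ne_zero ha]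
      exact hdist _ (C.smul_mem _ x.2)
  · obtain ⟨⟨x, hx, hx0, hxd⟩, -⟩ := hmin
    refine ⟨(⟨x, hx⟩, 0), fun h => hx0 (congrArg (fun p => (p.1 : Fin n → F)) h), ?_⟩
    simp [hφ, hammingNorm_sumElim, hxd]
  · rintro ⟨x, a⟩ h
    have hx : (x : Fin n → F) = 0 := hC.eq_zero x.2 fun y hy => by
      simpa [hdot] using h (⟨y, hy⟩, 0)
    have ha : a = 0 := by simpa [hdot, hwt] using h (0, 1)
    exact Prod.ext (Subtype.ext hx) ha

theorem existsLCDCode_juxtapose {e : ℕ} {C : LinearCode F n} (hk : finrank F C = k)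
    (hmin : HasMinWeight C d) (hC : IsLCD C) (σ : C →ₗ[F] ι → F)
    (hσ : ∀ v w, σ v ⬝ᵥ σ w = 0) (hwt : ∀ v ≠ 0, hammingNorm (σ v) = e) :
    ExistsLCDCode F (n + Fintype.card ι) k (d + e) := by
  let φ : C →ₗ[F] Fin n ⊕ ι → F :=
    (LinearEquiv.sumArrowLequivProdArrow _ _ F F).symm.toLinearMap.comp (C.subtype.prod σ)
  have hφ (x : C) : φ x = Sum.elim (x : Fin n → F) (σ x) := by
    ext (i | i) <;> rfl
  refine existsLCDCode_of_linearMap φ (by simp) hk ?_ ?_ ?_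
  · intro x hx
    rw [hφ, hammingNorm_sumElim, hwt x hx]
    exact Nat.add_le_add_right (hmin.2 ⟨x, x.2, by simpa using hx, rfl⟩) e
  · obtain ⟨⟨x, hx, hx0, hxd⟩, -⟩ := hmin
    have hne : (⟨x, hx⟩ : C) ≠ 0 := by simpa [Subtype.ext_iff] using hx0
    exact ⟨⟨x, hx⟩, hne, by rw [hφ, hammingNorm_sumElim, hwt _ hne, hxd]⟩
  · intro x h
    refine Subtype.ext (hC.eq_zero x.2 fun y hy => ?_)
    simpa [hφ, sumElim_dotProduct_sumElim, hσ] using h ⟨y, hy⟩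

end LCD

section Ternary

variable {n k d : ℕ}

theorem dotProduct_self_eq_hammingNorm {ι : Type*} [Fintype ι] (x : ι → ZMod 3) :
    x ⬝ᵥ x = hammingNorm x := by
  have hsq (a : ZMod 3) : a * a = if a ≠ 0 then 1 else 0 := by decide +revert
  simp only [dotProduct, hammingNorm, hsq, Finset.sum_boole]

theorem ExistsLCDCode.pred (h : ExistsLCDCode (ZMod 3) n (k + 1) d) (hk : k ≠ 0) (hd : ¬ 3 ∣ d) :
    ExistsLCDCode (ZMod 3) n k d := by
  obtain ⟨C, hdim, ⟨⟨w, hwC, hw0, hwd⟩, hmin⟩, hC⟩ := h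
  have hww : w ⬝ᵥ w ≠ 0 := by
    rwa [dotProduct_self_eq_hammingNorm, ← hwd, Ne, ZMod.natCast_eq_zero_iff]
  have hrank : finrank (ZMod 3) ↥(C ⊓ dual (ZMod 3 ∙ w)) = k := by
    have := finrank_inf_dual_span_singleton hwC hww
    omega
  obtain ⟨v, hv, hvv⟩ := (hC.inf_dual_span_singleton hwC hww).exists_dotProduct_self_ne_zero
    (by decide) fun hbot => hk (by rw [← hrank, hbot, finrank_bot])
  have hwv : w ∈ dual (ZMod 3 ∙ v) := by
    rw [mem_dual_span_singleton, dotProduct_comm]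
    exact mem_dual_span_singleton.1 hv.2
  refine ⟨C ⊓ dual (ZMod 3 ∙ v), ?_, ⟨⟨w, ⟨hwC, hwv⟩, hw0, hwd⟩, ?_⟩,
    hC.inf_dual_span_singleton hv.1 hvv⟩
  · have := finrank_inf_dual_span_singleton hv.1 hvv
    omega
  · rintro _ ⟨x, hx, hx0, rfl⟩
    exact hmin ⟨x, hx.1, hx0, rfl⟩

end Ternary

/-! ### Simplex codes -/

section Simplex

variable {F V : Type*} [Field F] [AddCommGroup V] [Module F V]

variable (F V) in
/-- The encoder of the simplex code: the columns of its generator matrix are representatives of the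
points of the dual projective space. -/
noncomputable def simplexEncoder : V →ₗ[F] ℙ F (Dual F V) → F :=
  LinearMap.pi fun p => p.rep

variable [Finite F] {k : ℕ}

theorem card_dual_apply_ne_zero (hV : finrank F V = k + 1) {v : V} (hv : v ≠ 0) :
    Nat.card {f : Dual F V // f v ≠ 0} = Nat.card F ^ k * (Nat.card F - 1) := by
  classical
  have : Module.Finite F V := Module.finite_of_finrank_eq_succ hV
  have : Finite (Dual F V) := Module.finite_of_finite F
  have heval : Dual.eval F V v ≠ 0 := by
    rw [Ne, (injective_iff_map_eq_zero' _).1 (eval_apply_injective F)]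
    exact hv
  have hker : Nat.card {f : Dual F V // f v = 0} = Nat.card F ^ k := by
    have hrank := Dual.finrank_ker_add_one_of_ne_zero heval
    rw [Subspace.dual_finrank_eq, hV, Nat.add_right_cancel_iff] at hrank
    rw [← hrank]
    exact Module.natCard_eq_pow_finrank (K := F) (V := LinearMap.ker (Dual.eval F V v))
  have hall : Nat.card (Dual F V) = Nat.card F ^ (k + 1) := by
    rw [Module.natCard_eq_pow_finrank (K := F), Subspace.dual_finrank_eq, hV]
  have hsum := Nat.card_congr (Equiv.sumCompl fun f : Dual F V => f v = 0)
  rw [Nat.card_sum, hker, hall, pow_succ] at hsum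
  rw [Nat.mul_sub, mul_one, ← hsum, Nat.add_sub_cancel_left]

theorem hammingNorm_simplexEncoder [DecidableEq F] [Fintype (ℙ F (Dual F V))]
    (hV : finrank F V = k + 1) {v : V} (hv : v ≠ 0) :
    hammingNorm (simplexEncoder F V v) = Nat.card F ^ k := by
  let scale : {p : ℙ F (Dual F V) // p.rep v ≠ 0} × Fˣ → {f : Dual F V // f v ≠ 0} :=
    fun q => ⟨q.2 • q.1.1.rep, by
      rw [Units.smul_def, LinearMap.smul_apply]
      exact smul_ne_zero q.2.ne_zero q.1.2⟩
  have hscale : Function.Bijective scale := by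
    constructor
    · rintro ⟨⟨p, hp⟩, a⟩ ⟨⟨q, hq⟩, b⟩ h
      have hab : a • p.rep = b • q.rep := congrArg Subtype.val h
      obtain rfl : p = q := by
        rw [← p.mk_rep, ← q.mk_rep, Projectivization.mk_eq_mk_iff]
        exact ⟨a⁻¹ * b, by rw [mul_smul, ← hab, inv_smul_smul]⟩
      have hval : (a : F) = b := by
        have := LinearMap.congr_fun hab v
        simpa [Units.smul_def, hp] using this
      rw [Units.ext hval]
    · rintro ⟨f, hf⟩
      have hf0 : f ≠ 0 := fun h => hf (by rw [h, LinearMap.zero_apply])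
      obtain ⟨a, ha⟩ := Projectivization.exists_smul_eq_mk_rep F f hf0
      refine ⟨(⟨.mk F f hf0, ?_⟩, a⁻¹), Subtype.ext ?_⟩
      · rw [← ha, Units.smul_def, LinearMap.smul_apply]
        exact smul_ne_zero a.ne_zero hf
      · change a⁻¹ • _ = f
        rw [← ha, inv_smul_smul]
  have hcard := Nat.card_eq_of_bijective scale hscale
  rw [Nat.card_prod, Nat.card_units, card_dual_apply_ne_zero hV hv, Nat.card_eq_fintype_card,
    Fintype.card_subtype] at hcard
  exact Nat.eq_of_mul_eq_mul_right (Nat.sub_pos_of_lt Finite.one_lt_card) hcard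

end Simplex

section AddSimplex

variable {n k d : ℕ}

theorem simplexEncoder_dotProduct {V : Type*} [AddCommGroup V] [Module (ZMod 3) V]
    [Fintype (ℙ (ZMod 3) (Dual (ZMod 3) V))]
    (hV : 2 ≤ finrank (ZMod 3) V) (v w : V) :
    simplexEncoder (ZMod 3) V v ⬝ᵥ simplexEncoder (ZMod 3) V w = 0 := by
  refine dotProduct_eq_zero_of_forall_self (by decide) _ (fun u => ?_) v w
  obtain rfl | hu := eq_or_ne u 0
  · rw [map_zero, zero_dotProduct]
  · obtain ⟨m, hm⟩ := Nat.exists_eq_add_of_le' hV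
    rw [dotProduct_self_eq_hammingNorm, hammingNorm_simplexEncoder hm hu, Nat.card_zmod,
      ZMod.natCast_eq_zero_iff]
    exact dvd_pow_self 3 m.succ_ne_zero

theorem ExistsLCDCode.add_simplex (h : ExistsLCDCode (ZMod 3) n k d) (hk : 2 ≤ k) (s : ℕ) :
    ExistsLCDCode (ZMod 3) (n + (3 ^ k - 1) / 2 * s) k (d + 3 ^ (k - 1) * s) := by
  induction s with
  | zero => exact h
  | succ s ih =>
    obtain ⟨C, hdim, hmin, hC⟩ := ih
    have : Finite (Dual (ZMod 3) C) := Module.finite_of_finite (ZMod 3)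
    have : Fintype (ℙ (ZMod 3) (Dual (ZMod 3) C)) := Fintype.ofFinite _
    have hlength : Fintype.card (ℙ (ZMod 3) (Dual (ZMod 3) C)) = (3 ^ k - 1) / 2 := by
      rw [← Nat.card_eq_fintype_card, Projectivization.card'',
        Module.natCard_eq_pow_finrank (K := ZMod 3), Nat.card_zmod, Subspace.dual_finrank_eq, hdim]
    have hext := existsLCDCode_juxtapose hdim hmin hC (simplexEncoder (ZMod 3) C)
      (simplexEncoder_dotProduct (hk.trans_eq hdim.symm)) fun v hv =>
      hammingNorm_simplexEncoder (by omega : finrank (ZMod 3) C = (k - 1) + 1) hv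
    rwa [hlength, Nat.card_zmod, add_assoc, add_assoc, ← Nat.mul_succ, ← Nat.mul_succ] at hext

end AddSimplex

/-! ### Parity-check codes -/

section ParityCheck

variable {F : Type*} [Field F] {n r d : ℕ}

/-- The code with parity-check matrix `H`. -/
def parityCheckCode (H : Matrix (Fin r) (Fin n) F) : LinearCode F n := LinearMap.ker H.mulVecLin

variable {H : Matrix (Fin r) (Fin n) F}

theorem mem_parityCheckCode {x : Fin n → F} : x ∈ parityCheckCode H ↔ H *ᵥ x = 0 :=
  LinearMap.mem_ker

theorem row_mem_dual_parityCheckCode (i : Fin r) : H i ∈ dual (parityCheckCode H) :=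
  fun _ hx => congrFun (mem_parityCheckCode.1 hx) i

theorem isLCD_parityCheckCode (hH : IsUnit (H * Hᵀ)) : IsLCD (parityCheckCode H) := by
  rw [Matrix.isUnit_iff_isUnit_det] at hH
  refine isLCD_of_forall_eq_zero fun x hx horth => dotProduct_eq_zero _ fun z => ?_
  let y := (H * Hᵀ)⁻¹ *ᵥ H *ᵥ z
  have hproj : z - Hᵀ *ᵥ y ∈ parityCheckCode H := by
    rw [mem_parityCheckCode, mulVec_sub, mulVec_mulVec, mulVec_mulVec, mul_nonsing_inv _ hH,
      one_mulVec, sub_self]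
  have hxy : x ⬝ᵥ Hᵀ *ᵥ y = 0 := by
    rw [dotProduct_mulVec, vecMul_transpose, mem_parityCheckCode.1 hx, zero_dotProduct]
  simpa only [dotProduct_sub, hxy, sub_zero] using horth _ hproj

theorem finrank_parityCheckCode (hH : IsUnit (H * Hᵀ)) :
    finrank F (parityCheckCode H) = n - r := by
  rw [Matrix.isUnit_iff_isUnit_det] at hH
  have hsurj : Function.Surjective H.mulVecLin := fun y =>
    ⟨Hᵀ *ᵥ (H * Hᵀ)⁻¹ *ᵥ y, by
      rw [mulVecLin_apply, mulVec_mulVec, mulVec_mulVec, mul_nonsing_inv _ hH, one_mulVec]⟩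
  have hrank := LinearMap.finrank_range_add_finrank_ker H.mulVecLin
  rw [LinearMap.range_eq_top.2 hsurj, finrank_top, finrank_fin_fun, finrank_fin_fun] at hrank
  exact Nat.eq_sub_of_add_eq' hrank

theorem existsLCDCode_of_hasMinWeight_parityCheckCode [DecidableEq F] (hH : IsUnit (H * Hᵀ))
    (hmin : HasMinWeight (parityCheckCode H) d) : ExistsLCDCode F n (n - r) d :=
  ⟨parityCheckCode H, finrank_parityCheckCode hH, hmin, isLCD_parityCheckCode hH⟩

end ParityCheck

/-! ### Sets of ternary vectors -/

/-- A subset of `𝔽₃ ^ r`, packed into a natural number: `x` is a member if and only if the bit at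
position `Bitset.index x` is set. The kernel computes with such sets fast enough to decide
statements about all vectors of small weight. -/
structure Bitset (r : ℕ) where
  /-- The characteristic function of the set. -/
  bits : ℕ

namespace Bitset

variable {r : ℕ}

/-- The number with ternary digits `x 0, x 1, …`, least significant first: the position of the bit
of `x` in a `Bitset`. -/
def index (x : Fin r → ZMod 3) : ℕ := (finFunctionFinEquiv (m := 3) x : Fin (3 ^ r))

instance : Membership (Fin r → ZMod 3) (Bitset r) := ⟨fun S x => S.bits.testBit (index x) = true⟩

instance (S : Bitset r) (x : Fin r → ZMod 3) : Decidable (x ∈ S) :=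
  inferInstanceAs (Decidable (_ = true))

instance : Union (Bitset r) := ⟨fun S T => ⟨S.bits ||| T.bits⟩⟩

theorem mem_iff {S : Bitset r} {x : Fin r → ZMod 3} : x ∈ S ↔ S.bits.testBit (index x) = true :=
  Iff.rfl

theorem mem_union {S T : Bitset r} {x : Fin r → ZMod 3} : x ∈ S ∪ T ↔ x ∈ S ∨ x ∈ T := by
  simp only [mem_iff, Union.union, Nat.testBit_or, Bool.or_eq_true]

/-- Disjointness of two sets. -/
def disjoint (S T : Bitset r) : Bool := S.bits &&& T.bits == 0

theorem notMem_of_disjoint {S T : Bitset r} (h : S.disjoint T) {x : Fin r → ZMod 3} (hS : x ∈ S) :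
    x ∉ T := by
  intro hT
  have hbit := congrArg (Nat.testBit · (index x)) (beq_iff_eq.1 h)
  simp [mem_iff.1 hS, mem_iff.1 hT] at hbit

theorem index_lt (x : Fin r → ZMod 3) : index x < 3 ^ r := Fin.isLt _

theorem index_eq_sum (x : Fin r → ZMod 3) : index x = ∑ i, (x i).val * 3 ^ (i : ℕ) :=
  finFunctionFinEquiv_apply (m := 3) x

/-- The set `{0}`. -/
def origin : Bitset r := ⟨1⟩

theorem zero_mem_origin : (0 : Fin r → ZMod 3) ∈ (origin : Bitset r) := by
  have hindex : index (0 : Fin r → ZMod 3) = 0 := by simp [index_eq_sum]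
  simp [mem_iff, origin, hindex]

theorem index_div_mod (x : Fin r → ZMod 3) (j : Fin r) :
    index x / 3 ^ (j : ℕ) % 3 = (x j).val :=
  congrArg (fun y : Fin r → Fin 3 => (y j : ℕ)) (finFunctionFinEquiv.symm_apply_apply x)

theorem index_add_single (x : Fin r → ZMod 3) (j : Fin r) :
    index (x + Pi.single j 1) + (x j).val * 3 ^ (j : ℕ) =
      index x + (x j + 1).val * 3 ^ (j : ℕ) := by
  have hrest : ∀ i ∈ Finset.univ.erase j,
      ((x + Pi.single j 1 : Fin r → ZMod 3) i).val * 3 ^ (i : ℕ) = (x i).val * 3 ^ (i : ℕ) := by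
    intro i hi
    rw [Pi.add_apply, Pi.single_eq_of_ne (Finset.ne_of_mem_erase hi), add_zero]
  rw [index_eq_sum, index_eq_sum, ← Finset.add_sum_erase _ _ (Finset.mem_univ j),
    ← Finset.add_sum_erase _ (fun i => (x i).val * 3 ^ (i : ℕ)) (Finset.mem_univ j),
    Finset.sum_congr rfl hrest, Pi.add_apply, Pi.single_eq_same]
  ring

/-- The bit pattern of the set of all `x : 𝔽₃ ^ r` with `x j = 0`. -/
def digitZeroMask (j : ℕ) : ℕ → ℕ
  | 0 => 0
  | r + 1 =>
    if r = j then 2 ^ 3 ^ j - 1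
    else digitZeroMask j r ||| digitZeroMask j r <<< 3 ^ r ||| digitZeroMask j r <<< (2 * 3 ^ r)

theorem testBit_digitZeroMask (j r i : ℕ) :
    (digitZeroMask j r).testBit i = decide (j < r ∧ i < 3 ^ r ∧ i / 3 ^ j % 3 = 0) := by
  have hp : 0 < 3 ^ j := by positivity
  rw [Bool.eq_iff_iff, decide_eq_true_iff]
  induction r generalizing i with
  | zero => simp [digitZeroMask]
  | succ r ih =>
    rw [digitZeroMask]
    split_ifs with hrj
    · have h0 := Nat.div_eq_zero_iff_lt (x := i) hp
      have h3 := Nat.div_lt_iff_lt_mul (x := i) (y := 3) hp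
      rw [Nat.testBit_two_pow_sub_one, decide_eq_true_iff, hrj, pow_succ]
      generalize i / 3 ^ j = q at *
      omega
    · simp only [Nat.testBit_or, Nat.testBit_shiftLeft, Bool.or_eq_true, Bool.and_eq_true,
        decide_eq_true_iff, ih]
      rcases lt_or_ge j r with hjr | hjr
      · obtain ⟨c, hc⟩ : 3 ^ (j + 1) ∣ 3 ^ r := pow_dvd_pow 3 hjr
        have hdigit (b : ℕ) (hb : b * 3 ^ r ≤ i) : (i - b * 3 ^ r) / 3 ^ j % 3 = i / 3 ^ j % 3 := by
          have hbr : b * 3 ^ r = 3 ^ j * (3 * (b * c)) := by rw [hc]; ring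
          have hle : 3 * (b * c) ≤ i / 3 ^ j := by
            rwa [Nat.le_div_iff_mul_le hp, mul_comm, ← hbr]
          rw [hbr, Nat.sub_mul_div]
          omega
        have h1 := hdigit 1
        have h2 := hdigit 2
        rw [pow_succ]
        grind
      · have : ¬ j < r + 1 := by omega
        simp [this, hjr.not_gt]

/-- Translation by the `j`-th unit vector: the positions with digit `0` or `1` at `j` move up by
`3 ^ j`, those with digit `2` move down by `2 * 3 ^ j`. -/
def shift (j : Fin r) (S : Bitset r) : Bitset r :=
  let m := digitZeroMask j r
  ⟨(S.bits &&& (m ||| m <<< 3 ^ (j : ℕ))) <<< 3 ^ (j : ℕ) |||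
    (S.bits >>> (2 * 3 ^ (j : ℕ)) &&& m)⟩

theorem add_single_mem_shift {j : Fin r} {S : Bitset r} {x : Fin r → ZMod 3} :
    x + Pi.single j 1 ∈ shift j S ↔ x ∈ S := by
  have hlt := index_lt x
  have hlt' := index_lt (x + Pi.single j 1)
  have hdigit := index_div_mod x j
  have hdigit' := index_div_mod (x + Pi.single j 1) j
  have hadd := index_add_single x j
  have hval : (x j + 1).val = ((x j).val + 1) % 3 := ZMod.val_add _ _
  rw [Pi.add_apply, Pi.single_eq_same, hval] at hdigit'
  rw [hval] at hadd
  simp only [mem_iff, shift, Nat.testBit_or, Nat.testBit_and, Nat.testBit_shiftLeft,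
    Nat.testBit_shiftRight, testBit_digitZeroMask, Bool.or_eq_true, Bool.and_eq_true,
    decide_eq_true_iff, j.isLt]
  generalize index x = i at *
  generalize index (x + Pi.single j 1) = i' at *
  have hp : 0 < 3 ^ (j : ℕ) := by positivity
  have hdiv_sub (i : ℕ) : (i - 3 ^ (j : ℕ)) / 3 ^ (j : ℕ) = i / 3 ^ (j : ℕ) - 1 := by
    simpa using Nat.sub_mul_div i (3 ^ (j : ℕ)) 1
  have hle (i : ℕ) : 3 ^ (j : ℕ) ≤ i ↔ 0 < i / 3 ^ (j : ℕ) := by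
    rw [Nat.div_pos_iff, and_iff_right hp]
  generalize 3 ^ (j : ℕ) = p at *
  generalize S.bits.testBit = f
  have ha : (x j).val < 3 := ZMod.val_lt _
  interval_cases (x j).val
  · obtain rfl : i' = i + p := by omega
    rw [Nat.add_sub_cancel]
    grind
  · obtain rfl : i' = i + p := by omega
    rw [Nat.add_sub_cancel]
    grind
  · obtain rfl : i = 2 * p + i' := by omega
    have hdiv_sub_sub := hdiv_sub (i' - p)
    grind

/-- The set of all `x + v` with `x ∈ S`. -/
def translate (v : Fin r → ZMod 3) (S : Bitset r) : Bitset r :=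
  (List.finRange r).foldl (fun T j => (shift j)^[(v j).val] T) S

theorem add_smul_single_mem_iterate_shift {j : Fin r} {S : Bitset r} {x : Fin r → ZMod 3} (k : ℕ) :
    x + k • Pi.single j 1 ∈ (shift j)^[k] S ↔ x ∈ S := by
  induction k generalizing x with
  | zero => simp
  | succ k ih =>
    rw [Function.iterate_succ_apply', succ_nsmul, ← add_assoc, add_single_mem_shift, ih]

theorem add_mem_translate {v x : Fin r → ZMod 3} {S : Bitset r} :
    x + v ∈ translate v S ↔ x ∈ S := by
  have hfold (l : List (Fin r)) (T : Bitset r) (y : Fin r → ZMod 3) :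
      y + (l.map fun j => Pi.single j (v j)).sum ∈
        l.foldl (fun T j => (shift j)^[(v j).val] T) T ↔ y ∈ T := by
    induction l generalizing T y with
    | nil => simp
    | cons j l ih =>
      have hsingle : (Pi.single j (v j) : Fin r → ZMod 3) = (v j).val • Pi.single j 1 := by
        rw [← Pi.single_smul, nsmul_one, ZMod.natCast_zmod_val]
      rw [List.map_cons, List.sum_cons, ← add_assoc, List.foldl_cons, ih, hsingle,
        add_smul_single_mem_iterate_shift]
  have h := hfold (List.finRange r) S x
  rwa [← Fin.sum_univ_def, Finset.univ_sum_single] at h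

end Bitset

/-! ### Syndromes of words of small weight -/

/-- The set of all `∑ i, x i • c i` with `hammingNorm x ≤ t`. -/
def syndromeBall {r : ℕ} : (n : ℕ) → (Fin n → Fin r → ZMod 3) → ℕ → Bitset r
  | 0, _, _ => .origin
  | _ + 1, _, 0 => .origin
  | n + 1, c, t + 1 =>
    let S := syndromeBall n (Fin.tail c) t
    syndromeBall n (Fin.tail c) (t + 1) ∪ (S.translate (c 0) ∪ S.translate (-c 0))

theorem sum_smul_mem_syndromeBall {r n t : ℕ} (c : Fin n → Fin r → ZMod 3) {x : Fin n → ZMod 3}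
    (hx : hammingNorm x ≤ t) : ∑ i, x i • c i ∈ syndromeBall n c t := by
  induction n generalizing t with
  | zero => exact Bitset.zero_mem_origin
  | succ n ih =>
    cases t with
    | zero =>
      obtain rfl : x = 0 := by simpa using hx
      simpa [syndromeBall] using Bitset.zero_mem_origin
    | succ t =>
      rw [hammingNorm_succ] at hx
      rw [Fin.sum_univ_succ, add_comm (x 0 • c 0), syndromeBall, Bitset.mem_union, Bitset.mem_union]
      obtain h0 | h1 | h2 : x 0 = 0 ∨ x 0 = 1 ∨ x 0 = -1 := by generalize x 0 = a; decide +revert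
      · left
        rw [h0, zero_smul, add_zero]
        exact ih (Fin.tail c) (x := Fin.tail x) (by simpa [h0] using hx)
      · right; left
        rw [h1, one_smul, Bitset.add_mem_translate]
        rw [h1, if_pos one_ne_zero] at hx
        exact ih (Fin.tail c) (x := Fin.tail x) (by omega)
      · right; right
        rw [h2, neg_one_smul, Bitset.add_mem_translate]
        rw [h2, if_pos (neg_ne_zero.2 one_ne_zero)] at hx
        exact ih (Fin.tail c) (x := Fin.tail x) (by omega)

/-- A test that no non-trivial combination of at most `2 * t + 2` of the vectors `c i` vanishes.
If `i` is the first index in a vanishing combination, then the at most `2 * t + 1` later terms split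
into `t + 1` and `t`, so that, up to signs, the ball of radius `t + 1` spanned by the later vectors
meets the translate by `c i` of the one of radius `t`. -/
def separatesBalls {r : ℕ} : (n : ℕ) → (Fin n → Fin r → ZMod 3) → ℕ → Bool
  | 0, _, _ => true
  | n + 1, c, t => separatesBalls n (Fin.tail c) t &&
    (syndromeBall n (Fin.tail c) (t + 1)).disjoint
      ((syndromeBall n (Fin.tail c) t).translate (c 0))

theorem sum_smul_ne_zero_of_separatesBalls {r n t : ℕ} {c : Fin n → Fin r → ZMod 3}
    (hc : separatesBalls n c t) {x : Fin n → ZMod 3} (hx : x ≠ 0)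
    (hwt : hammingNorm x ≤ 2 * t + 2) : ∑ i, x i • c i ≠ 0 := by
  induction n with
  | zero => exact absurd (Subsingleton.elim x 0) hx
  | succ n ih =>
    obtain ⟨hc', hdisj⟩ := Bool.and_eq_true_iff.1 hc
    rw [hammingNorm_succ] at hwt
    intro hsum
    rw [Fin.sum_univ_succ] at hsum
    by_cases h0 : x 0 = 0
    · refine ih (c := Fin.tail c) (x := Fin.tail x) hc' ?_ (by simpa [h0] using hwt) ?_
      · contrapose! hx
        ext i
        exact Fin.cases h0 (congrFun hx) i
      · rwa [h0, zero_smul, zero_add] at hsum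
    · have hwt' : hammingNorm (Fin.tail x) ≤ (t + 1) + t := by
        rw [if_pos h0] at hwt
        omega
      obtain ⟨y, z, hyz, hy, hz⟩ := exists_eq_add_of_hammingNorm_le hwt'
      let φ := Fintype.linearCombination (ZMod 3) (Fin.tail c)
      have hφ : x 0 • c 0 + (φ y + φ z) = 0 := by rwa [← map_add, ← hyz]
      have hsq : x 0 * x 0 = 1 := by generalize x 0 = a at h0; decide +revert
      have hmeet : φ (-x 0 • y) = φ (x 0 • z) + c 0 := by
        have hscaled := congrArg (x 0 • ·) hφ
        rw [smul_add, smul_smul, hsq, one_smul, smul_add, smul_zero] at hscaled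
        rw [map_smul, map_smul, neg_smul, neg_eq_iff_add_eq_zero, ← hscaled]
        abel
      rw [← hammingNorm_smul_of_ne_zero (neg_ne_zero.2 h0)] at hy
      rw [← hammingNorm_smul_of_ne_zero h0] at hz
      have hmem : φ (-x 0 • y) ∈ syndromeBall n (Fin.tail c) (t + 1) :=
        sum_smul_mem_syndromeBall _ hy
      refine Bitset.notMem_of_disjoint hdisj hmem ?_
      rw [hmeet, Bitset.add_mem_translate]
      exact sum_smul_mem_syndromeBall _ hz

section TernaryParityCheck

variable {n r d t : ℕ} {H : Matrix (Fin r) (Fin n) (ZMod 3)}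

theorem hasMinWeight_parityCheckCode (hH : separatesBalls n Hᵀ t) {x : Fin n → ZMod 3}
    (hx : H *ᵥ x = 0) (hwt : hammingNorm x = 2 * t + 3) :
    HasMinWeight (parityCheckCode H) (2 * t + 3) := by
  refine ⟨⟨x, mem_parityCheckCode.2 hx, hammingNorm_ne_zero_iff.1 (by omega), hwt.symm⟩, ?_⟩
  rintro _ ⟨y, hy, hy0, rfl⟩
  by_contra! hlt
  refine sum_smul_ne_zero_of_separatesBalls hH hy0 (by omega) ?_
  simpa only [mulVec_eq_sum, op_smul_eq_smul] using mem_parityCheckCode.1 hy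

theorem lt_hammingNorm_add_of_mem_parityCheckCode {w x : Fin n → ZMod 3}
    (hw : H *ᵥ w ∉ syndromeBall n Hᵀ t) (hx : x ∈ parityCheckCode H) :
    t < hammingNorm (x + w) := by
  by_contra! hle
  have hmem := sum_smul_mem_syndromeBall Hᵀ hle
  have hsyn : H *ᵥ (x + w) = H *ᵥ w := by rw [mulVec_add, mem_parityCheckCode.1 hx, zero_add]
  refine hw ?_
  simpa only [← hsyn, mulVec_eq_sum, op_smul_eq_smul] using hmem

theorem existsLCDCode_lengthen_parityCheckCode (hH : IsUnit (H * Hᵀ))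
    (hmin : HasMinWeight (parityCheckCode H) d) {i : Fin r} (hi : H i ⬝ᵥ H i ≠ 0)
    (hball : H *ᵥ H i ∉ syndromeBall n Hᵀ t) (hd : d ≤ t + 4) :
    ExistsLCDCode (ZMod 3) (n + 3) (n - r + 1) d := by
  refine existsLCDCode_constructionX (finrank_parityCheckCode hH) hmin (isLCD_parityCheckCode hH)
    (row_mem_dual_parityCheckCode i) (t := fun _ : Fin 3 => 1) ?_ fun x hx => ?_
  · have htail : (fun _ : Fin 3 => (1 : ZMod 3)) ⬝ᵥ (fun _ => 1) = 0 := by decide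
    rwa [htail, add_zero]
  · have htail : hammingNorm (fun _ : Fin 3 => (1 : ZMod 3)) = 3 := by decide
    have := lt_hammingNorm_add_of_mem_parityCheckCode hball hx
    omega

end TernaryParityCheck

/-! ### The four codes -/

/-- A parity-check matrix of a `[34, 22, 7]` code, with orthogonal anisotropic rows. The first seven
columns add up to zero, which gives a word of weight `7`. -/
def parityCheck34 : Matrix (Fin 12) (Fin 34) (ZMod 3) :=
  !![1, 2, 0, 2, 1, 1, 2, 1, 1, 1, 1, 0, 1, 0, 1, 1, 1, 1, 1, 1,
      1, 0, 0, 1, 1, 0, 0, 1, 1, 1, 0, 1, 0, 1;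
    0, 2, 2, 0, 2, 0, 0, 1, 2, 2, 2, 1, 1, 1, 1, 1, 2, 2, 1, 2,
      1, 1, 1, 2, 0, 0, 0, 2, 0, 0, 1, 1, 1, 1;
    0, 1, 1, 1, 0, 2, 1, 2, 1, 2, 2, 2, 2, 1, 2, 1, 1, 1, 0, 0,
      0, 2, 2, 0, 2, 1, 1, 0, 0, 2, 2, 0, 1, 1;
    2, 1, 2, 0, 2, 2, 0, 1, 1, 2, 0, 1, 2, 2, 1, 2, 2, 0, 0, 2,
      1, 0, 1, 1, 2, 0, 0, 0, 2, 1, 0, 2, 0, 0;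
    0, 0, 2, 0, 0, 0, 1, 1, 2, 0, 1, 0, 0, 1, 2, 2, 1, 0, 0, 0,
      2, 1, 1, 0, 2, 0, 1, 1, 1, 1, 2, 0, 1, 0;
    0, 0, 0, 0, 1, 1, 1, 1, 1, 1, 0, 2, 1, 2, 2, 1, 1, 2, 0, 1,
      0, 0, 1, 0, 1, 0, 2, 0, 2, 0, 1, 1, 2, 2;
    2, 1, 2, 2, 1, 0, 1, 1, 1, 1, 0, 1, 0, 0, 0, 0, 0, 0, 0, 1,
      1, 2, 0, 1, 2, 1, 0, 1, 1, 2, 1, 1, 2, 0;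
    1, 2, 0, 0, 2, 1, 0, 0, 2, 0, 0, 2, 0, 2, 1, 1, 2, 1, 0, 2,
      1, 2, 0, 0, 1, 1, 1, 1, 1, 1, 1, 2, 0, 0;
    1, 2, 0, 2, 1, 1, 2, 0, 0, 0, 1, 1, 0, 1, 2, 1, 1, 2, 0, 0,
      1, 2, 2, 0, 1, 0, 1, 0, 1, 1, 0, 1, 2, 0;
    1, 0, 2, 1, 1, 0, 1, 1, 1, 0, 1, 1, 0, 1, 0, 1, 0, 1, 1, 0,
      1, 1, 1, 2, 2, 0, 0, 1, 1, 1, 1, 2, 2, 2;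
    0, 1, 2, 1, 2, 2, 1, 0, 2, 0, 0, 2, 2, 1, 1, 0, 1, 2, 0, 0,
      1, 1, 1, 1, 0, 0, 0, 2, 0, 1, 1, 0, 2, 1;
    0, 0, 2, 1, 2, 1, 0, 0, 1, 2, 2, 2, 1, 0, 2, 0, 0, 0, 2, 2,
      0, 0, 0, 0, 1, 1, 0, 2, 0, 0, 0, 0, 2, 1]

theorem isUnit_parityCheck34_mul_transpose : IsUnit (parityCheck34 * parityCheck34ᵀ) :=
  .of_mul_eq_one (parityCheck34 * parityCheck34ᵀ) (by decide +kernel)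

theorem hasMinWeight_parityCheck34 : HasMinWeight (parityCheckCode parityCheck34) 7 :=
  hasMinWeight_parityCheckCode (t := 2) (x := fun j => if j < 7 then 1 else 0)
    (by decide +kernel) (by decide +kernel) (by decide +kernel)

theorem existsLCDCode_34_22_7 : ExistsLCDCode (ZMod 3) 34 22 7 :=
  existsLCDCode_of_hasMinWeight_parityCheckCode isUnit_parityCheck34_mul_transpose
    hasMinWeight_parityCheck34

theorem existsLCDCode_37_23_7 : ExistsLCDCode (ZMod 3) 37 23 7 :=
  existsLCDCode_lengthen_parityCheckCode isUnit_parityCheck34_mul_transpose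
    hasMinWeight_parityCheck34 (i := 0) (t := 3) (by decide +kernel) (by decide +kernel) le_rfl

/-- A parity-check matrix of a `[37, 29, 5]` code, with orthonormal rows. The first five columns add
up to zero, which gives a word of weight `5`. -/
def parityCheck37 : Matrix (Fin 8) (Fin 37) (ZMod 3) :=
  !![2, 2, 2, 0, 0, 1, 0, 1, 0, 1, 0, 1, 1, 0, 0, 1, 1, 1, 0, 1,
      1, 1, 0, 1, 1, 0, 0, 1, 0, 1, 1, 1, 0, 1, 1, 0, 0;
    0, 1, 1, 2, 2, 0, 0, 1, 1, 2, 1, 2, 2, 1, 0, 0, 2, 2, 1, 0,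
      1, 2, 1, 0, 1, 1, 1, 2, 0, 2, 2, 2, 1, 1, 2, 1, 0;
    2, 2, 2, 0, 0, 0, 1, 0, 0, 1, 2, 1, 0, 1, 1, 0, 0, 2, 1, 0,
      0, 2, 2, 2, 0, 1, 1, 0, 1, 1, 2, 1, 0, 0, 0, 1, 1;
    0, 1, 1, 2, 2, 0, 2, 2, 0, 0, 1, 2, 1, 1, 1, 1, 0, 2, 2, 2,
      1, 0, 2, 0, 1, 1, 1, 2, 2, 1, 1, 1, 1, 0, 0, 2, 1;
    2, 0, 1, 2, 1, 0, 1, 0, 0, 1, 0, 0, 1, 2, 2, 2, 2, 2, 2, 1,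
      0, 2, 0, 2, 2, 0, 2, 1, 2, 0, 0, 1, 2, 1, 0, 1, 1;
    1, 0, 0, 1, 1, 2, 1, 1, 0, 2, 2, 2, 2, 1, 2, 2, 1, 2, 2, 1,
      2, 2, 0, 1, 2, 0, 1, 0, 1, 2, 2, 0, 1, 2, 0, 0, 2;
    0, 1, 2, 2, 1, 0, 2, 0, 1, 1, 2, 0, 0, 0, 0, 0, 2, 0, 2, 1,
      2, 1, 0, 0, 0, 2, 0, 0, 2, 2, 2, 2, 1, 0, 2, 2, 2;
    1, 0, 0, 2, 0, 1, 2, 0, 1, 0, 1, 0, 0, 2, 1, 2, 0, 1, 0, 0,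
      2, 2, 0, 2, 2, 1, 0, 2, 2, 0, 0, 0, 0, 2, 0, 2, 0]

theorem isUnit_parityCheck37_mul_transpose : IsUnit (parityCheck37 * parityCheck37ᵀ) :=
  .of_mul_eq_one (parityCheck37 * parityCheck37ᵀ) (by decide +kernel)

theorem hasMinWeight_parityCheck37 : HasMinWeight (parityCheckCode parityCheck37) 5 :=
  hasMinWeight_parityCheckCode (t := 1) (x := fun j => if j < 5 then 1 else 0)
    (by decide +kernel) (by decide +kernel) (by decide +kernel)

theorem existsLCDCode_37_29_5 : ExistsLCDCode (ZMod 3) 37 29 5 :=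
  existsLCDCode_of_hasMinWeight_parityCheckCode isUnit_parityCheck37_mul_transpose
    hasMinWeight_parityCheck37

theorem existsLCDCode_40_30_5 : ExistsLCDCode (ZMod 3) 40 30 5 :=
  existsLCDCode_lengthen_parityCheckCode isUnit_parityCheck37_mul_transpose
    hasMinWeight_parityCheck37 (i := 0) (t := 1) (by decide +kernel) (by decide +kernel) le_rfl

end LCDCode

theorem mainTheorem11 (n k d : ℕ) (h : (n, k, d) ∈ LCDCode.P3 ∪ LCDCode.P3') (s : ℕ) :
    LCDCode.ExistsLCDCode (ZMod 3) (n + (3 ^ k - 1) / 2 * s) k (d + 3 ^ (k - 1) * s) := by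
  simp only [LCDCode.P3, LCDCode.P3', Finset.mem_union, Finset.mem_insert, Finset.mem_singleton,
    Prod.mk.injEq] at h
  suffices LCDCode.ExistsLCDCode (ZMod 3) n k d from this.add_simplex (by omega) s
  rcases h with (⟨rfl, rfl, rfl⟩ | ⟨rfl, rfl, rfl⟩ | ⟨rfl, rfl, rfl⟩ | ⟨rfl, rfl, rfl⟩) |
    ⟨rfl, rfl, rfl⟩ | ⟨rfl, rfl, rfl⟩ | ⟨rfl, rfl, rfl⟩ | ⟨rfl, rfl, rfl⟩
  · exact LCDCode.existsLCDCode_34_22_7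
  · exact LCDCode.existsLCDCode_37_23_7
  · exact LCDCode.existsLCDCode_37_29_5
  · exact LCDCode.existsLCDCode_40_30_5
  · exact LCDCode.existsLCDCode_34_22_7.pred (by norm_num) (by norm_num)
  · exact LCDCode.existsLCDCode_37_23_7.pred (by norm_num) (by norm_num)
  · exact LCDCode.existsLCDCode_37_29_5.pred (by norm_num) (by norm_num)
  · exact LCDCode.existsLCDCode_40_30_5.pred (by norm_num) (by norm_num)
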